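/- Let $\mathcal G=(\mathcal V,\mathcal E,\{\varphi_e\}_{e\in\mathcal E})$ be a graph with Euclidean edges: $(\mathcal V,\mathcal E)$ is a finite simple connected graph, every edge $e$ is identified with a set of points, also denoted $e$ (these sets and $\mathcal V$ are mutually disjoint), and $\varphi_e$ is a bijection that maps $e$ onto an open interval $(\underline e,\overline e)\subset\mathbb R$ and the two end vertices of $e$ onto its endpoints. Write $u\in\mathcal G$ for $u\in\mathcal V\cup\bigcup_e e$. Fix a vertex $u_0$. Let $c(u,v)=1/(\overline e-\underline e)$ if $u,v\in\mathcal V$ are joined by the edge $e$, $c(u,v)=0$ otherwise, and $c(u)=\sum_v c(u,v)$. Let $L$ be the matrix with $L(u_0,u_0)=1+c(u_0)$, $L(u,u)=c(u)$ for $u\ne u_0$, and $L(u,v)=-c(u,v)$ for $u\neq v$. Let $$Z_{\mathcal G}(u)=Z_\mu(u)+\sum_{e\in\mathcal E}Z_e(u),\qquad u\in\mathcal G,$$ where $(Z_\mu(v))_{v\in\mathcal V}\sim\mathcal N(0,L^{-1})$ and $Z_\mu$ is interpolated linearly along every edge, $Z_e(u)=B_e(\varphi_e(u))$ for $u\in e$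 and $Z_e(u)=0$ otherwise, and the $B_e$ are standard Brownian bridges on $[\underline e,\overline e]$, vanishing at the endpoints, that are independent of each other and of $Z_\mu$. The resistance metric is $d_R(u,v)=\operatorname{var}(Z_{\mathcal G}(u)-Z_{\mathcal G}(v))$. Let $f:\mathbb R\to\mathbb R$ be square-integrable, let $X$ be a Poisson point process on $\mathbb R$ with intensity $1$, independent of $Z_{\mathcal G}$, and let $\epsilon(x)$, $x\in X$, be independent signs with $\mathbb P(\epsilon(x)=1)=\mathbb P(\epsilon(x)=-1)=1/2$, attached to the points of $X$ and independent of $X$ and $Z_{\mathcal G}$ (that is, along some measurable enumeration $x_0,x_1,\dots$ of the points of $X$, the $\epsilon(x_n)$ are i.i.d. and independent of $((x_n)_n,Z_{\mathcal G})$). Let $$Y(u)=\sum_{x\in X}\epsilon(x)\,f\big(Z_{\mathcal G}(u)-x\big),\qquad u\in\mathcal G,$$ where the sum is the limit of the sums over $X\cap[-k,k]$ as $k\to\infty$. Then: 1. For every $u\in\mathcal G$ and every increasing sequence of intervals $I_k=[c_k,d_k]$ with union $\mathbb R$, almost surely $\sum_{x\in X\cap I_k}\epsilon(x)f(Z_{\mathcal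 G}(u)-x)\to Y(u)$ as $k\to\infty$. 2. For every $u\in\mathcal G$, $Y(u)$ is square-integrable and $\mathbb E\,Y(u)=0$. 3. $Y$ is isotropic with respect to the resistance metric: there is a function $C_Y$ with $\operatorname{cov}(Y(u),Y(v))=C_Y(d_R(u,v))$ for all $u,v\in\mathcal G$. Explicitly, $$\operatorname{cov}(Y(u),Y(v))=\frac1{\sqrt{2\pi}}\int_{\mathbb R}\psi_f\big(\sqrt{d_R(u,v)}\,z\big)e^{-z^2/2}\,dz,\qquad u,v\in\mathcal G,$$ where $\psi_f(h)=\int_{\mathbb R}f(x+h)f(x)\,dx$ is the transitive covariogram of $f$, and all these integrals converge absolutely. -/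

import Mathlib

open MeasureTheory ProbabilityTheory Filter Topology
open scoped ENNReal NNReal

noncomputable section

/-- A graph with Euclidean edges on the finite vertex set `V`: a simple connected graph, a set of
points `edgePts e` for every edge `e`, and a coordinate `φ e`, which is a bijection of `edgePts e`
onto the open interval `(lo e, hi e)` and sends the end vertex `src e` of `e` to `lo e` and the
other end vertex `tgt e` to `hi e`. -/
structure EuclideanEdgeGraph (V : Type*) where
  graph : SimpleGraph V
  connected : graph.Connected
  edgePts : graph.edgeSet → Type*
  src : graph.edgeSet → V
  tgt : graph.edgeSet → V
  ends : ∀ e, s(src e, tgt e) = (e : Sym2 V)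
  lo : graph.edgeSet → ℝ
  hi : graph.edgeSet → ℝ
  lo_lt_hi : ∀ e, lo e < hi e
  φ : ∀ e, edgePts e ≃ Set.Ioo (lo e) (hi e)

namespace EuclideanEdgeGraph

variable {V : Type*} (G : EuclideanEdgeGraph V)

/-- The points of the graph: its vertices and the points of its edges. -/
inductive Point
  | vertex (v : V)
  | onEdge (e : G.graph.edgeSet) (x : G.edgePts e)

/-- The length of an edge. -/
def length (e : G.graph.edgeSet) : ℝ := G.hi e - G.lo e

open Classical in
/-- `c(u, v)`: the inverse length of the edge joining `u` and `v`, and `0` if there is none. -/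
def conductance (u v : V) : ℝ :=
  if h : G.graph.Adj u v then 1 / G.length ⟨s(u, v), h⟩ else 0

/-- The modified Laplacian matrix `L`, with the extra term `1` at the diagonal entry of `u₀`. -/
def laplacian [Fintype V] [DecidableEq V] (u₀ : V) : Matrix V V ℝ := fun u v =>
  if u = v then (if u = u₀ then 1 else 0) + ∑ w, G.conductance u w
  else -G.conductance u v

variable {Ω : Type*}

/-- The linear interpolation to the whole graph of a field given at the vertices. -/
def interpolation (Zμ : V → Ω → ℝ) : G.Point → Ω → ℝ
  | .vertex v, ω => Zμ v ω
  | .onEdge e x, ω =>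
      let d : ℝ := ((G.φ e x : ℝ) - G.lo e) / G.length e
      (1 - d) * Zμ (G.src e) ω + d * Zμ (G.tgt e) ω

open Classical in
/-- `Z_e`: the process `B e` read along the edge `e`, and `0` outside this edge. -/
def edgeField (B : ∀ e, Set.Icc (G.lo e) (G.hi e) → Ω → ℝ) (e : G.graph.edgeSet) :
    G.Point → Ω → ℝ
  | .vertex _, _ => 0
  | .onEdge e' x, ω =>
      if e' = e then B e' ⟨G.φ e' x, Set.Ioo_subset_Icc_self (G.φ e' x).2⟩ ω else 0

/-- The field `Z_G = Z_μ + ∑ₑ Z_e` on the whole graph; the sum runs over the finitely many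
edges. -/
def auxiliaryField (Zμ : V → Ω → ℝ) (B : ∀ e, Set.Icc (G.lo e) (G.hi e) → Ω → ℝ)
    (u : G.Point) (ω : Ω) : ℝ :=
  G.interpolation Zμ u ω + ∑ᶠ e : G.graph.edgeSet, G.edgeField B e u ω

end EuclideanEdgeGraph

/-- `B` is a standard Brownian bridge on `[a, b]`, from `0` at `a` to `0` at `b`: a centred Gaussian
process with covariance `(s - a) (b - t) / (b - a)` for `s ≤ t` and continuous paths. -/
structure IsBrownianBridge {Ω : Type*} [MeasurableSpace Ω] (a b : ℝ)
    (B : Set.Icc a b → Ω → ℝ) (P : Measure Ω) : Prop where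
  gaussian : IsGaussianProcess B P
  mean : ∀ t, ∫ ω, B t ω ∂P = 0
  cov : ∀ s t, cov[B s, B t; P] = (min (s : ℝ) t - a) * (b - max (s : ℝ) t) / (b - a)
  continuous_paths : ∀ᵐ ω ∂P, Continuous fun t => B t ω

/-- The building blocks of the field `Z_G`: the values `Zμ` at the vertices have the law
`N(0, L⁻¹)`, and `B` is a family of independent Brownian bridges, one for each edge, independent of
`Zμ`. -/
structure EuclideanEdgeGraph.IsAuxiliary {V : Type*} [Fintype V] [DecidableEq V]
    (G : EuclideanEdgeGraph V) {Ω : Type*} [MeasurableSpace Ω] (u₀ : V) (Zμ : V → Ω → ℝ)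
    (B : ∀ e, Set.Icc (G.lo e) (G.hi e) → Ω → ℝ) (P : Measure Ω) : Prop where
  measurable_vertices : ∀ v, Measurable (Zμ v)
  measurable_bridges : ∀ e t, Measurable (B e t)
  law_vertices : HasLaw (fun ω => WithLp.toLp 2 fun v => Zμ v ω)
    (multivariateGaussian 0 (G.laplacian u₀)⁻¹) P
  bridges : ∀ e, IsBrownianBridge (G.lo e) (G.hi e) (B e) P
  indep_bridges : iIndepFun (fun e ω t => B e t ω) P
  indep_vertices_bridges : IndepFun (fun ω v => Zμ v ω) (fun ω e t => B e t ω) P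

/-- The variogram `var (Z u - Z v)` of a field; that of `Z_G` is the resistance metric. -/
def variogram {S Ω : Type*} [MeasurableSpace Ω] (Z : S → Ω → ℝ) (P : Measure Ω) (u v : S) : ℝ :=
  Var[fun ω => Z u ω - Z v ω; P]

/-- The resistance metric `d_R(u, v) = var (Z_G(u) - Z_G(v))` of a graph with Euclidean edges. -/
def EuclideanEdgeGraph.resistanceMetric {V : Type*} (G : EuclideanEdgeGraph V) {Ω : Type*}
    [MeasurableSpace Ω] (Zμ : V → Ω → ℝ) (B : ∀ e, Set.Icc (G.lo e) (G.hi e) → Ω → ℝ)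
    (P : Measure Ω) : G.Point → G.Point → ℝ :=
  variogram (G.auxiliaryField Zμ B) P

/-- The covariance function of a random field. -/
def covFun {S Ω : Type*} [MeasurableSpace Ω] (Y : S → Ω → ℝ) (P : Measure Ω) (u v : S) : ℝ :=
  cov[Y u, Y v; P]

/-- A function of two points is isotropic for `d` if it is a function of `d` alone. -/
def IsIsotropic {S : Type*} (K d : S → S → ℝ) : Prop :=
  ∃ C : ℝ → ℝ, ∀ u v, K u v = C (d u v)

/-- The number of points of the random set `X` in `A`. -/
def pointCount {Ω : Type*} (X : Ω → Set ℝ) (A : Set ℝ) (ω : Ω) : ℕ∞ := (X ω ∩ A).encard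

/-- `X` is a Poisson point process on `ℝ` with intensity one (with respect to Lebesgue measure):
a random locally finite set, whose number of points in a Borel set of finite length is Poisson
distributed with the length as parameter, and whose numbers of points in disjoint Borel sets are
independent. -/
structure IsUnitPoissonProcess {Ω : Type*} [MeasurableSpace Ω] (X : Ω → Set ℝ) (P : Measure Ω) :
    Prop where
  locallyFinite : ∀ ω a b, (X ω ∩ Set.Icc a b).Finite
  measurable_count : ∀ A, MeasurableSet A → Measurable (pointCount X A)
  law_count : ∀ A, MeasurableSet A → volume A ≠ ∞ →
    HasLaw (pointCount X A)
      ((poissonMeasure (volume A).toNNReal).map (Nat.cast : ℕ → ℕ∞)) P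
  indep_count : ∀ (k : ℕ) (A : Fin k → Set ℝ), (∀ i, MeasurableSet (A i)) →
    Pairwise (fun i j => Disjoint (A i) (A j)) → iIndepFun (fun i => pointCount X (A i)) P

/-- The point process `X` is independent of the random field `Z`. -/
def PointProcessIndep {S Ω : Type*} [MeasurableSpace Ω] (X : Ω → Set ℝ) (Z : S → Ω → ℝ)
    (P : Measure Ω) : Prop :=
  IndepFun (fun ω (A : {A : Set ℝ // MeasurableSet A}) => pointCount X A ω)
    (fun ω u => Z u ω) P

/-- The weights `ε x` at the points `x` of `X` are mutually independent random signs, independent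
of `X` and `Z`: along some measurable enumeration `T 0, T 1, …` of `X` without repetitions they form
an i.i.d. sequence of Rademacher variables that is independent of `T` and `Z`.

(Since the points are random, a condition on `ε x` for each deterministic `x` would not restrict
the weights at the points of `X` at all: almost surely, a given `x` is not one of them.) -/
def IsRademacherMarking {S Ω : Type*} [MeasurableSpace Ω] (X : Ω → Set ℝ) (ε : ℝ → Ω → ℝ)
    (Z : S → Ω → ℝ) (P : Measure Ω) : Prop :=
  ∃ T : ℕ → Ω → ℝ, (∀ n, Measurable (T n)) ∧
    (∀ᵐ ω ∂P, Function.Injective (fun n => T n ω) ∧ Set.range (fun n => T n ω) = X ω) ∧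
    (∀ n, Measurable fun ω => ε (T n ω) ω) ∧
    (∀ n, P {ω | ε (T n ω) ω = 1} = 1 / 2 ∧ P {ω | ε (T n ω) ω = -1} = 1 / 2) ∧
    iIndepFun (fun n ω => ε (T n ω) ω) P ∧
    IndepFun (fun ω n => ε (T n ω) ω) (fun ω => (fun n => T n ω, fun u => Z u ω)) P

/-- The sum `∑ ε(x) f(Z(u) - x)` over the finitely many points `x` of `X` in `[a, b]`. -/
def windowSum {S Ω : Type*} (X : Ω → Set ℝ) (ε : ℝ → Ω → ℝ) (f : ℝ → ℝ) (Z : S → Ω → ℝ)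
    (a b : ℝ) (u : S) (ω : Ω) : ℝ :=
  ∑ᶠ x ∈ X ω ∩ Set.Icc a b, ε x ω * f (Z u ω - x)

/-- The Poisson dilution field `Y(u) = ∑ ε(x) f(Z(u) - x)`, `x` running through `X`. The series
need not converge absolutely; it is the limit of its sums over the windows `[-k, k]`. -/
def dilutionField {S Ω : Type*} (X : Ω → Set ℝ) (ε : ℝ → Ω → ℝ) (f : ℝ → ℝ) (Z : S → Ω → ℝ)
    (u : S) (ω : Ω) : ℝ :=
  limUnder atTop fun k : ℕ => windowSum X ε f Z (-k) k u ω

/-- The transitive covariogram of `f`. -/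
def covariogram (f : ℝ → ℝ) (h : ℝ) : ℝ := ∫ x, f (x + h) * f x

end

/-! Enumerate the points of `X` as `T n`, with signs `ξ n`. Since the signs are centred, independent
and independent of `(T, Z)`, the terms `ξ n * f (Z u - T n)` are orthogonal in `L²(P)`, and terms of
`Y u` and `Y v` with different indices are orthogonal too. By Campbell's formula
(`IsUnitPoissonProcess.sum_map_eq_prod`), summing over the points and taking the mean amounts to
integrating over the law of `(Z u, Z v)` times Lebesgue measure. The diagonal terms therefore sum to
the mean of `∫ f (Z u - x) f (Z v - x) dx = covariogram f (Z u - Z v)`. With `u = v` this gives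
convergence in `L²`, and in general it gives the covariance.

Almost sure convergence is conditional on `(T, Z)`: the coefficients are then fixed and
square-summable, and a Rademacher series along growing finite index sets is an `L²`-bounded
martingale (`IsRademacherSequence.exists_ae_tendsto_sum`). Fubini removes the conditioning
(`IsRademacherSequence.ae_tendsto_finsum_of_indepFun`). The limit is the same for all windows,
because it agrees with the `L²` sum.

The graph enters through `EuclideanEdgeGraph.IsAuxiliary.map_sub_eq_gaussianReal`: `Z u - Z v` is
centred Gaussian with variance `d_R(u, v)`, so the mean of the covariogram depends on `d_R(u, v)`
alone. -/

/-- An orthogonal sequence with square-summable norms is summable in a Hilbert space. -/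
theorem summable_of_pairwise_inner_eq_zero {H : Type*} [NormedAddCommGroup H]
    [InnerProductSpace ℝ H] [CompleteSpace H] {g : ℕ → H}
    (horth : Pairwise fun i j => inner ℝ (g i) (g j) = 0)
    (hsum : Summable fun n => ‖g n‖ ^ 2) : Summable g := by
  -- Lines spanned by the vectors are used instead of normalised vectors, since some `g n` may
  -- vanish.
  have hV : OrthogonalFamily ℝ (fun n => Submodule.span ℝ {g n})
      (fun n => (Submodule.span ℝ {g n}).subtypeₗᵢ) := by
    intro i j hij v w
    obtain ⟨a, ha⟩ := Submodule.mem_span_singleton.1 v.2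
    obtain ⟨b, hb⟩ := Submodule.mem_span_singleton.1 w.2
    simp [← ha, ← hb, inner_smul_left, inner_smul_right, horth hij]
  exact (hV.summable_iff_norm_sq_summable
    (fun n => ⟨g n, Submodule.mem_span_singleton_self _⟩)).2 hsum

/-! ### Rademacher series -/

/-- A sequence of independent random signs. -/
structure IsRademacherSequence {Ω : Type*} [MeasurableSpace Ω] (ξ : ℕ → Ω → ℝ) (P : Measure Ω) :
    Prop where
  measurable : ∀ n, Measurable (ξ n)
  law : ∀ n, P {ω | ξ n ω = 1} = 1 / 2 ∧ P {ω | ξ n ω = -1} = 1 / 2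
  indep : iIndepFun ξ P

namespace IsRademacherSequence

variable {Ω : Type*} [MeasurableSpace Ω] {P : Measure Ω} [IsProbabilityMeasure P]
  {ξ : ℕ → Ω → ℝ}

theorem ae_eq_one_or (h : IsRademacherSequence ξ P) (n : ℕ) :
    ∀ᵐ ω ∂P, ξ n ω = 1 ∨ ξ n ω = -1 := by
  have hm : ∀ c : ℝ, MeasurableSet {ω | ξ n ω = c} := fun c =>
    h.measurable n (measurableSet_singleton c)
  have hd : Disjoint {ω | ξ n ω = 1} {ω | ξ n ω = -1} := by
    rw [Set.disjoint_left]
    intro ω h1 h2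
    simp only [Set.mem_ofPred_eq] at h1 h2
    linarith
  have hP : P ({ω | ξ n ω = 1} ∪ {ω | ξ n ω = -1}) = 1 := by
    rw [measure_union hd (hm _), (h.law n).1, (h.law n).2]
    exact ENNReal.add_halves 1
  exact (prob_compl_eq_zero_iff ((hm 1).union (hm (-1)))).2 hP

theorem ae_norm_le (h : IsRademacherSequence ξ P) (n : ℕ) : ∀ᵐ ω ∂P, ‖ξ n ω‖ ≤ 1 := by
  filter_upwards [h.ae_eq_one_or n] with ω hω
  rcases hω with hω | hω <;> simp [hω]

theorem memLp (h : IsRademacherSequence ξ P) (n : ℕ) (p : ℝ≥0∞) : MemLp (ξ n) p P :=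
  MemLp.of_bound (h.measurable n).aestronglyMeasurable 1 (h.ae_norm_le n)

theorem integral_eq_zero (h : IsRademacherSequence ξ P) (n : ℕ) : ∫ ω, ξ n ω ∂P = 0 := by
  have hm : ∀ c : ℝ, MeasurableSet {ω | ξ n ω = c} := fun c =>
    h.measurable n (measurableSet_singleton c)
  have he : ξ n =ᵐ[P] fun ω => {ω | ξ n ω = 1}.indicator (fun _ => (1 : ℝ)) ω
      - {ω | ξ n ω = -1}.indicator (fun _ => (1 : ℝ)) ω := by
    filter_upwards [h.ae_eq_one_or n] with ω hω
    rcases hω with hω | hω <;> norm_num [Set.indicator, hω]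
  rw [integral_congr_ae he, integral_sub ((integrable_const _).indicator (hm _))
    ((integrable_const _).indicator (hm _)), integral_indicator_const _ (hm _),
    integral_indicator_const _ (hm _)]
  simp [Measure.real, (h.law n).1, (h.law n).2]

theorem integral_mul (h : IsRademacherSequence ξ P) (m n : ℕ) :
    ∫ ω, ξ m ω * ξ n ω ∂P = if m = n then 1 else 0 := by
  split_ifs with hmn
  · subst hmn
    have : (fun ω => ξ m ω * ξ m ω) =ᵐ[P] fun _ => 1 := by
      filter_upwards [h.ae_eq_one_or m] with ω hω
      rcases hω with hω | hω <;> norm_num [hω]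
    rw [integral_congr_ae this]
    simp
  · have := (h.indep.indepFun hmn).integral_mul_eq_mul_integral
      (h.measurable m).aestronglyMeasurable (h.measurable n).aestronglyMeasurable
    simpa [h.integral_eq_zero] using this

/-- The partial sums of a Rademacher series along an increasing sequence of finite index sets form
a martingale. -/
theorem exists_martingale_sum (h : IsRademacherSequence ξ P) (a : ℕ → ℝ) {F : ℕ → Finset ℕ}
    (hF : Monotone F) :
    ∃ ℱ : Filtration ℕ ‹MeasurableSpace Ω›,
      Martingale (fun k ω => ∑ n ∈ F k, a n * ξ n ω) ℱ P := by
  let m : ℕ → MeasurableSpace Ω := fun n => MeasurableSpace.comap (ξ n) inferInstance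
  have hm : ∀ n, m n ≤ ‹MeasurableSpace Ω› := fun n => (h.measurable n).comap_le
  have hsm : ∀ (s : Finset ℕ) (S : Set ℕ), (∀ n ∈ s, n ∈ S) →
      StronglyMeasurable[⨆ n ∈ S, m n] (fun ω => ∑ n ∈ s, a n * ξ n ω) := by
    intro s S hs
    refine Measurable.stronglyMeasurable ?_
    refine Finset.measurable_fun_sum s fun n hn => ?_
    refine Measurable.const_mul ?_ _
    exact (comap_measurable (ξ n)).mono (le_iSup₂_of_le n (hs n hn) le_rfl) le_rfl
  let ℱ : Filtration ℕ ‹MeasurableSpace Ω› :=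
    { seq := fun k => ⨆ n ∈ (F k : Set ℕ), m n
      mono' := fun i j hij => biSup_mono fun n hn => hF hij hn
      le' := fun k => iSup₂_le fun n _ => hm n }
  have hint : ∀ s : Finset ℕ, Integrable (fun ω => ∑ n ∈ s, a n * ξ n ω) P := fun s =>
    integrable_finsetSum _ fun n _ => ((h.memLp n 1).integrable le_rfl).const_mul _
  refine ⟨ℱ, martingale_of_condExp_sub_eq_zero_nat (fun k => hsm _ _ fun n hn => hn)
    (fun k => hint _) fun k => ?_⟩
  have hsub : (fun ω => ∑ n ∈ F (k + 1), a n * ξ n ω) - (fun ω => ∑ n ∈ F k, a n * ξ n ω)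
      = fun ω => ∑ n ∈ F (k + 1) \ F k, a n * ξ n ω := by
    ext ω
    simp [Finset.sum_sdiff_eq_sub (hF (Nat.le_succ k))]
  rw [hsub]
  -- The signs that enter at time `k + 1` are independent of the past, and centred, so the increment
  -- has conditional mean zero.
  have hind : Indep (⨆ n ∈ ((F (k + 1) \ F k : Finset ℕ) : Set ℕ), m n)
      (⨆ n ∈ (F k : Set ℕ), m n) P := by
    refine indep_iSup_of_disjoint hm h.indep.iIndep ?_
    exact Finset.disjoint_coe.2 Finset.sdiff_disjoint
  refine (condExp_indep_eq (iSup₂_le fun n _ => hm n) (ℱ.le k) (hsm _ _ fun n hn => hn)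
    hind).trans ?_
  rw [integral_finsetSum _ fun n _ => ((h.memLp n 1).integrable le_rfl).const_mul _]
  simp [integral_const_mul, h.integral_eq_zero]
  rfl

/-- A Rademacher series with square-summable coefficients converges almost surely along every
exhausting sequence of finite index sets, and the limit does not depend on the sequence. -/
theorem exists_ae_tendsto_sum (h : IsRademacherSequence ξ P) {a : ℕ → ℝ}
    (ha : Summable fun n => a n ^ 2) :
    ∃ S : Ω → ℝ, ∀ F : ℕ → Finset ℕ, Monotone F → (∀ n, ∃ k, n ∈ F k) →
      ∀ᵐ ω ∂P, Tendsto (fun k => ∑ n ∈ F k, a n * ξ n ω) atTop (𝓝 (S ω)) := by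
  have hmem : ∀ n, MemLp (fun ω => a n * ξ n ω) 2 P := fun n => (h.memLp n 2).const_mul _
  obtain ⟨g, hgc⟩ : ∃ g : ℕ → Lp ℝ 2 P, ∀ n, g n =ᵐ[P] fun ω => a n * ξ n ω :=
    ⟨fun n => (hmem n).toLp, fun n => (hmem n).coeFn_toLp⟩
  have hin : ∀ m n, inner ℝ (g m) (g n) = if m = n then a m ^ 2 else 0 := by
    intro m n
    rw [L2.inner_def]
    have : (fun ω => inner ℝ (g m ω) (g n ω)) =ᵐ[P]
        fun ω => (a m * a n) * (ξ m ω * ξ n ω) := by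
      filter_upwards [hgc m, hgc n] with ω h1 h2
      simp only [h1, h2, RCLike.inner_apply, conj_trivial]
      ring
    rw [integral_congr_ae this, integral_const_mul, h.integral_mul]
    split_ifs with hmn
    · subst hmn; ring
    · simp
  have hg : Summable g := by
    refine summable_of_pairwise_inner_eq_zero
      (fun i j hij => (hin i j).trans (if_neg hij)) (ha.congr fun n => ?_)
    rw [← real_inner_self_eq_norm_sq, hin, if_pos rfl]
  -- The candidate limit is the unconditional `L²` sum, chosen before `F`; this is why it does not
  -- depend on `F`.
  refine ⟨(∑' n, g n : Lp ℝ 2 P), fun F hF hex => ?_⟩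
  have hcoe : ∀ s : Finset ℕ, (fun ω => ∑ n ∈ s, a n * ξ n ω) =ᵐ[P] (∑ n ∈ s, g n : Lp ℝ 2 P) := by
    intro s
    have h1 : ∀ᵐ ω ∂P, ∀ n, g n ω = a n * ξ n ω := ae_all_iff.2 hgc
    filter_upwards [Lp.coeFn_fun_finsetSum s g, h1] with ω h2 h3
    rw [h2]
    exact Finset.sum_congr rfl fun n _ => (h3 n).symm
  have hL2 : Tendsto (fun k => ∑ n ∈ F k, g n) atTop (𝓝 (∑' n, g n)) :=
    hg.hasSum.comp (tendsto_atTop_finset_of_monotone hF hex)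
  have hmeas := (tendstoInMeasure_of_tendsto_Lp hL2).congr_left fun k => (hcoe (F k)).symm
  obtain ⟨ℱ, hM⟩ := h.exists_martingale_sum a hF
  have hms : ∀ k, AEStronglyMeasurable (fun ω => ∑ n ∈ F k, a n * ξ n ω) P := fun k =>
    (Lp.aestronglyMeasurable (∑ n ∈ F k, g n)).congr (hcoe _).symm
  -- Convergence in `L²` bounds the `L¹` norms, so the martingale converges almost surely;
  -- uniqueness of limits in measure then identifies its limit with the `L²` sum.
  obtain ⟨R, hR⟩ : ∃ R : ℝ≥0, ∀ k, eLpNorm (fun ω => ∑ n ∈ F k, a n * ξ n ω) 1 P ≤ R := by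
    obtain ⟨C, hC⟩ := hL2.norm.bddAbove_range
    refine ⟨C.toNNReal, fun k => ?_⟩
    refine (eLpNorm_le_eLpNorm_of_exponent_le (by norm_num : (1 : ℝ≥0∞) ≤ 2) (hms k)).trans ?_
    rw [eLpNorm_congr_ae (hcoe _), ← ENNReal.ofReal_toReal (Lp.eLpNorm_ne_top _)]
    exact ENNReal.ofReal_le_ofReal (hC ⟨k, rfl⟩)
  have hconv := hM.submartingale.ae_tendsto_limitProcess hR
  have huniq := tendstoInMeasure_ae_unique (tendstoInMeasure_of_tendsto_ae hms hconv) hmeas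
  filter_upwards [hconv, huniq] with ω h1 h2
  rwa [← h2]

end IsRademacherSequence

/-- A Rademacher series with random square-summable coefficients, independent of the signs,
converges almost surely along random exhausting sequences of finite index sets, to the limit of its
partial sums, as long as these index sets are also independent of the signs. -/
theorem IsRademacherSequence.ae_tendsto_finsum_of_indepFun {Ω E : Type*} [MeasurableSpace Ω]
    [MeasurableSpace E] {P : Measure Ω} [IsProbabilityMeasure P] {ξ : ℕ → Ω → ℝ}
    (h : IsRademacherSequence ξ P) {θ : Ω → E} (hθ : Measurable θ)
    (hind : IndepFun (fun ω n => ξ n ω) θ P) {a : ℕ → E → ℝ} (ha : ∀ n, Measurable (a n))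
    {A : ℕ → ℕ → Set E} (hA : ∀ k n, MeasurableSet (A k n))
    (hsum : ∀ᵐ ω ∂P, Summable fun n => a n (θ ω) ^ 2)
    (hfin : ∀ᵐ ω ∂P, ∀ k, {n | θ ω ∈ A k n}.Finite)
    (hmono : ∀ᵐ ω ∂P, ∀ n, Monotone fun k => θ ω ∈ A k n)
    (hex : ∀ᵐ ω ∂P, ∀ n, ∃ k, θ ω ∈ A k n) :
    ∀ᵐ ω ∂P, ∃ s,
      Tendsto (fun k => ∑ᶠ n ∈ {n | θ ω ∈ A k n}, a n (θ ω) * ξ n ω) atTop (𝓝 s) ∧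
      Tendsto (fun N => ∑ n ∈ Finset.range N, a n (θ ω) * ξ n ω) atTop (𝓝 s) := by
  classical
  let x : Ω → ℕ → ℝ := fun ω n => ξ n ω
  have hx : Measurable x := measurable_pi_lambda _ h.measurable
  -- Fubini needs a measurable event on the product space. As a limit of partial sums with
  -- indicators, `M k` is measurable, and it equals the finite sum over the random index set
  -- whenever that set is finite (`hMeq`).
  let M : ℕ → E × (ℕ → ℝ) → ℝ := fun k p => limUnder atTop fun N : ℕ =>
    ∑ n ∈ Finset.range N, (A k n).indicator (a n) p.1 * p.2 n
  let S : ℕ → E × (ℕ → ℝ) → ℝ := fun N p => ∑ n ∈ Finset.range N, a n p.1 * p.2 n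
  have hMm : ∀ k, Measurable (M k) := by
    refine fun k => (StronglyMeasurable.limUnder fun N => ?_).measurable
    refine (Finset.measurable_fun_sum _ fun n _ => ?_).stronglyMeasurable
    exact (((ha n).indicator (hA k n)).comp measurable_fst).mul
      ((measurable_pi_apply n).comp measurable_snd)
  have hSm : ∀ N, Measurable (S N) := by
    refine fun N => Finset.measurable_fun_sum _ fun n _ => ?_
    exact ((ha n).comp measurable_fst).mul ((measurable_pi_apply n).comp measurable_snd)
  let D : Set (E × (ℕ → ℝ)) := {p | ∃ s, Tendsto (fun N => S N p) atTop (𝓝 s)} ∩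
    {p | Tendsto (fun k => M k p - S k p) atTop (𝓝 0)}
  have hD : MeasurableSet D :=
    (measurableSet_exists_tendsto hSm).inter
      (measurableSet_tendsto (𝓝 0) fun k => (hMm k).sub (hSm k))
  have hMeq : ∀ k e y, {n | e ∈ A k n}.Finite →
      M k (e, y) = ∑ᶠ n ∈ {n | e ∈ A k n}, a n e * y n := by
    intro k e y hf
    refine Tendsto.limUnder_eq ?_
    have h1 : Function.support (fun n => (A k n).indicator (a n) e * y n) ⊆ hf.toFinset := by
      intro n hn
      simp only [Set.Finite.coe_toFinset, Set.mem_ofPred_eq]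
      by_contra hc
      simp [hc] at hn
    have h2 := (hasSum_sum_of_ne_finset_zero (s := hf.toFinset)
      (f := fun n => (A k n).indicator (a n) e * y n)
      fun n hn => Function.notMem_support.1 fun hc => hn (h1 hc)).tendsto_sum_nat
    convert h2 using 2
    rw [finsum_mem_eq_finite_toFinset_sum _ hf]
    refine Finset.sum_congr rfl fun n hn => ?_
    have : e ∈ A k n := by simpa using hn
    simp [this]
  -- With `θ ω` frozen, coefficients and index sets are deterministic, and both ways of summing have
  -- the same limit.
  have hae : ∀ᵐ ω ∂P, ∀ᵐ ω' ∂P, (θ ω, x ω') ∈ D := by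
    filter_upwards [hsum, hfin, hmono, hex] with ω h1 h2 h3 h4
    obtain ⟨s, hs⟩ := h.exists_ae_tendsto_sum h1
    have hF := hs (fun k => (h2 k).toFinset)
      (fun i j hij n hn => by
        simp only [Set.Finite.mem_toFinset, Set.mem_ofPred_eq] at hn ⊢
        exact h3 n hij hn)
      (fun n => (h4 n).imp fun k hk => by simpa using hk)
    have hR := hs Finset.range Finset.range_mono fun n => ⟨n + 1, by simp⟩
    filter_upwards [hF, hR] with ω' h5 h6
    refine ⟨⟨_, h6⟩, ?_⟩
    have := h5.sub h6
    rw [sub_self] at this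
    refine this.congr fun k => ?_
    rw [hMeq k _ _ (h2 k), finsum_mem_eq_finite_toFinset_sum _ (h2 k)]
  have hprod : ∀ᵐ p ∂(P.map θ).prod (P.map x), p ∈ D := by
    have : IsProbabilityMeasure (P.map x) := Measure.isProbabilityMeasure_map hx.aemeasurable
    rw [Measure.ae_prod_mem_iff_ae_ae_mem hD, ae_map_iff hθ.aemeasurable]
    · filter_upwards [hae] with ω hω
      exact (ae_map_iff hx.aemeasurable (measurable_prodMk_left hD)).2 hω
    · exact measurable_measure_prodMk_left hD.compl (measurableSet_singleton 0)
  rw [← (indepFun_iff_map_prod_eq_prod_map_map hθ.aemeasurable hx.aemeasurable).1 hind.symm]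
    at hprod
  filter_upwards [ae_of_ae_map (hθ.prodMk hx).aemeasurable hprod, hfin] with ω h1 h2
  obtain ⟨⟨s, hs⟩, h3⟩ := h1
  refine ⟨s, ?_, hs⟩
  have := Tendsto.add h3 hs
  simp only [sub_add_cancel, zero_add] at this
  exact this.congr fun k => hMeq k _ _ (h2 k)

/-! ### Campbell's formula for the Poisson process -/

theorem lintegral_cast_poissonMeasure (r : ℝ≥0) :
    ∫⁻ n : ℕ, (n : ℝ≥0∞) ∂(poissonMeasure r) = r := by
  have hone := measure_univ (μ := poissonMeasure r)
  rw [← lintegral_one] at hone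
  simp only [poissonMeasure, lintegral_sum_measure, lintegral_smul_measure, lintegral_dirac,
    smul_eq_mul, mul_one] at hone ⊢
  rw [tsum_eq_zero_add' ENNReal.summable]
  -- The Poisson weight at `n + 1`, times `n + 1`, is `r` times the weight at `n`; the mean is thus
  -- `r` times the total mass.
  have : ∀ n : ℕ, ENNReal.ofReal (Real.exp (-r) * r ^ (n + 1) / (n + 1).factorial)
      * ((n + 1 : ℕ) : ℝ≥0∞) = r * ENNReal.ofReal (Real.exp (-r) * r ^ n / n.factorial) := by
    intro n
    rw [← ENNReal.ofReal_natCast, ← ENNReal.ofReal_mul (by positivity),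
      ← ENNReal.ofReal_coe_nnreal, ← ENNReal.ofReal_mul (by positivity)]
    congr 1
    rw [Nat.factorial_succ]
    push_cast
    field_simp
    ring
  simp only [this, ENNReal.tsum_mul_left, hone]
  simp

/-- The number of points of an enumerated set in `A`, as a sum of indicators. -/
theorem encard_range_inter {T : ℕ → ℝ} (hT : Function.Injective T) (A : Set ℝ) :
    (((Set.range T ∩ A).encard : ℕ∞) : ℝ≥0∞) = ∑' n, A.indicator 1 (T n) := by
  rw [← Set.image_preimage_eq_range_inter, hT.encard_image, ← ENNReal.tsum_set_one,
    tsum_subtype (T ⁻¹' A) fun _ => (1 : ℝ≥0∞)]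
  rfl

theorem IsUnitPoissonProcess.lintegral_pointCount {Ω : Type*} [MeasurableSpace Ω] {P : Measure Ω}
    {X : Ω → Set ℝ} (hX : IsUnitPoissonProcess X P) {A : Set ℝ} (hA : MeasurableSet A)
    (hfin : volume A ≠ ∞) : ∫⁻ ω, (pointCount X A ω : ℝ≥0∞) ∂P = volume A := by
  have hlaw := hX.law_count A hA hfin
  rw [← lintegral_map (f := fun m : ℕ∞ => (m : ℝ≥0∞)) .of_discrete (hX.measurable_count A hA),
    hlaw.map_eq, lintegral_map .of_discrete .of_discrete]
  simp only [ENat.toENNReal_coe]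
  rw [lintegral_cast_poissonMeasure, ENNReal.coe_toNNReal hfin]

/-- Campbell's formula: the points of a unit Poisson process, together with an independent random
element `W`, have the intensity measure `law of W ⊗ volume`. -/
theorem IsUnitPoissonProcess.sum_map_eq_prod {Ω E : Type*} [MeasurableSpace Ω] [MeasurableSpace E]
    {P : Measure Ω} [IsProbabilityMeasure P] {X : Ω → Set ℝ} (hX : IsUnitPoissonProcess X P)
    {T : ℕ → Ω → ℝ} (hT : ∀ n, Measurable (T n))
    (hTX : ∀ᵐ ω ∂P, Function.Injective (fun n => T n ω) ∧ Set.range (fun n => T n ω) = X ω)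
    {W : Ω → E} (hW : Measurable W)
    (hind : IndepFun (fun ω (A : {A : Set ℝ // MeasurableSet A}) => pointCount X A ω) W P) :
    Measure.sum (fun n => P.map fun ω => (W ω, T n ω)) = (P.map W).prod volume := by
  have : IsProbabilityMeasure (P.map W) := Measure.isProbabilityMeasure_map hW.aemeasurable
  symm
  -- It suffices to compare the measures on rectangles `C ×ˢ A`. Restricting to `A` of finite length
  -- makes the count in `A` Poisson with finite mean.
  refine Measure.prod_eq_generateFrom (C := {C | MeasurableSet C})
    (D := {A | MeasurableSet A ∧ volume A < ∞}) MeasurableSpace.generateFrom_measurableSet ?_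
    MeasurableSpace.isPiSystem_measurableSet ?_ (Measure.toFiniteSpanningSetsIn _) ?_ ?_
  · refine le_antisymm (MeasurableSpace.generateFrom_le fun A hA => hA.1) ?_
    refine (BorelSpace.measurable_eq.trans (borel_eq_generateFrom_Icc ℝ)).le.trans
      (MeasurableSpace.generateFrom_mono ?_)
    rintro _ ⟨a, b, -, rfl⟩
    exact ⟨measurableSet_Icc, measure_Icc_lt_top⟩
  · exact fun s hs t ht _ => ⟨hs.1.inter ht.1, (measure_mono Set.inter_subset_left).trans_lt hs.2⟩
  · exact volume.toFiniteSpanningSetsIn.mono' fun A hA => hA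
  · rintro C hC A ⟨hA, hAfin⟩
    have hCA := MeasurableSet.prod hC hA
    rw [Measure.sum_apply _ hCA, Measure.map_apply hW hC]
    have h1 : ∀ n, P.map (fun ω => (W ω, T n ω)) (C ×ˢ A) =
        ∫⁻ ω, A.indicator 1 (T n ω) * C.indicator (1 : E → ℝ≥0∞) (W ω) ∂P := by
      intro n
      rw [Measure.map_apply (hW.prodMk (hT n)) hCA, ← lintegral_indicator_one
        ((hW.prodMk (hT n)) hCA)]
      refine lintegral_congr fun ω => ?_
      by_cases h1 : T n ω ∈ A <;> by_cases h2 : W ω ∈ C <;> simp [h1, h2, Set.indicator]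
    have hm : ∀ n, Measurable fun ω => A.indicator (1 : ℝ → ℝ≥0∞) (T n ω) := fun n =>
      (measurable_one.indicator hA).comp (hT n)
    have hmC : Measurable fun ω => C.indicator (1 : E → ℝ≥0∞) (W ω) :=
      (measurable_one.indicator hC).comp hW
    have hswap : ∑' n, ∫⁻ ω, A.indicator 1 (T n ω) * C.indicator (1 : E → ℝ≥0∞) (W ω) ∂P =
        ∫⁻ ω, ∑' n, A.indicator 1 (T n ω) * C.indicator (1 : E → ℝ≥0∞) (W ω) ∂P :=
      (lintegral_tsum fun n => ((hm n).mul hmC).aemeasurable).symm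
    simp only [h1, hswap, ENNReal.tsum_mul_right]
    -- Summed over `n`, the enumeration disappears: only the count in `A` remains, and that is
    -- independent of `W`.
    have h2 : (fun ω => (∑' n, A.indicator (1 : ℝ → ℝ≥0∞) (T n ω)) * C.indicator (1 : E → ℝ≥0∞) (W ω)) =ᵐ[P]
        (fun ω => (pointCount X A ω : ℝ≥0∞)) * fun ω => C.indicator (1 : E → ℝ≥0∞) (W ω) := by
      filter_upwards [hTX] with ω hω
      simp only [Pi.mul_apply, pointCount]
      rw [← hω.2, encard_range_inter hω.1]
    have hind' : IndepFun (fun ω => (pointCount X A ω : ℝ≥0∞)) (fun ω => C.indicator (1 : E → ℝ≥0∞) (W ω)) P :=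
      hind.comp ((Measurable.of_discrete (f := fun m : ℕ∞ => (m : ℝ≥0∞))).comp
        (measurable_pi_apply (⟨A, hA⟩ : {A : Set ℝ // MeasurableSet A})))
        (measurable_one.indicator hC)
    have hmX : Measurable fun ω => (pointCount X A ω : ℝ≥0∞) :=
      (Measurable.of_discrete (f := fun m : ℕ∞ => (m : ℝ≥0∞))).comp (hX.measurable_count A hA)
    rw [lintegral_congr_ae h2,
      lintegral_mul_eq_lintegral_mul_lintegral_of_indepFun hmX hmC hind', hX.lintegral_pointCount hA hAfin.ne, mul_comm]
    congr 1
    rw [← lintegral_indicator_one (hW hC)]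
    rfl

/-! ### Gaussian increments of the auxiliary field -/

namespace EuclideanEdgeGraph

variable {V : Type*} {G : EuclideanEdgeGraph V} {Ω : Type*}

/-- A continuous linear functional of the Gaussian vertex vector is again Gaussian, and centred with
it; this form covers vertices and edge points at once. -/
theorem exists_interpolation_eq [Fintype V] (Zμ : V → Ω → ℝ) (u : G.Point) :
    ∃ L : EuclideanSpace ℝ V →L[ℝ] ℝ, ∀ ω,
      G.interpolation Zμ u ω = L (WithLp.toLp 2 fun v => Zμ v ω) := by
  cases u with
  | vertex v => exact ⟨EuclideanSpace.proj v, fun ω => rfl⟩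
  | onEdge e x =>
    let d : ℝ := ((G.φ e x : ℝ) - G.lo e) / G.length e
    exact ⟨(1 - d) • EuclideanSpace.proj (G.src e) + d • EuclideanSpace.proj (G.tgt e),
      fun ω => by simp [interpolation, d]⟩

/-- Avoids later case distinctions: off the edge the coefficient is `0` and the parameter `G.lo e`
is a dummy. -/
theorem exists_edgeField_eq (B : ∀ e, Set.Icc (G.lo e) (G.hi e) → Ω → ℝ) (e : G.graph.edgeSet)
    (u : G.Point) : ∃ (c : ℝ) (s : Set.Icc (G.lo e) (G.hi e)), ∀ ω,
      G.edgeField B e u ω = c * B e s ω := by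
  cases u with
  | vertex v => exact ⟨0, ⟨G.lo e, le_rfl, (G.lo_lt_hi e).le⟩, fun ω => by simp [edgeField]⟩
  | onEdge e' x =>
    by_cases h : e' = e
    · subst h
      exact ⟨1, ⟨G.φ e' x, Set.Ioo_subset_Icc_self (G.φ e' x).2⟩, fun ω => by simp [edgeField]⟩
    · exact ⟨0, ⟨G.lo e, le_rfl, (G.lo_lt_hi e).le⟩, fun ω => by simp [edgeField, h]⟩

variable [Fintype V] [DecidableEq V] [MeasurableSpace Ω] {P : Measure Ω} {u₀ : V}
  {Zμ : V → Ω → ℝ} {B : ∀ e, Set.Icc (G.lo e) (G.hi e) → Ω → ℝ}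

theorem IsAuxiliary.measurable_auxiliaryField (hZ : G.IsAuxiliary u₀ Zμ B P) (u : G.Point) :
    Measurable (G.auxiliaryField Zμ B u) := by
  classical
  have : Fintype G.graph.edgeSet := Fintype.ofFinite _
  obtain ⟨L, hL⟩ := exists_interpolation_eq Zμ u
  choose c s hcs using fun e => exists_edgeField_eq B e u
  unfold auxiliaryField
  simp only [finsum_eq_sum_of_fintype, hL, hcs]
  refine Measurable.add ?_ (Finset.measurable_fun_sum _ fun e _ =>
    (hZ.measurable_bridges e (s e)).const_mul _)
  have hm := measurable_pi_lambda (fun ω v => Zμ v ω) hZ.measurable_vertices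
  have hL : Measurable fun z : V → ℝ => L (WithLp.toLp 2 z) := by fun_prop
  exact hL.comp hm

/-- The increments of the auxiliary field are centred Gaussian. -/
theorem IsAuxiliary.map_sub_eq_gaussianReal [IsProbabilityMeasure P]
    (hZ : G.IsAuxiliary u₀ Zμ B P) (u v : G.Point) :
    P.map (fun ω => G.auxiliaryField Zμ B u ω - G.auxiliaryField Zμ B v ω) =
      gaussianReal 0 (G.resistanceMetric Zμ B P u v).toNNReal := by
  classical
  have : Fintype G.graph.edgeSet := Fintype.ofFinite _
  obtain ⟨L, hL⟩ := exists_interpolation_eq Zμ u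
  obtain ⟨L', hL'⟩ := exists_interpolation_eq Zμ v
  choose c s hcs using fun e => exists_edgeField_eq B e u
  choose c' s' hcs' using fun e => exists_edgeField_eq B e v
  let I : Ω → ℝ := fun ω => (L - L') (WithLp.toLp 2 fun v => Zμ v ω)
  let D : G.graph.edgeSet → Ω → ℝ := fun e ω => c e * B e (s e) ω - c' e * B e (s' e) ω
  have hsub : (fun ω => G.auxiliaryField Zμ B u ω - G.auxiliaryField Zμ B v ω) =
      fun ω => I ω + ∑ e, D e ω := by
    ext ω
    simp only [auxiliaryField, finsum_eq_sum_of_fintype, hL, hL', hcs, hcs', I, D,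
      sub_apply, Finset.sum_sub_distrib]
    ring
  have hvec := hZ.law_vertices.hasGaussianLaw
  have hI : HasGaussianLaw I P := hvec.map_fun (L - L')
  have hD : ∀ e, HasGaussianLaw (D e) P := by
    intro e
    have := ((hZ.bridges e).gaussian.hasGaussianLaw_prodMk (s := s e) (t := s' e)).map_fun
      (c e • ContinuousLinearMap.fst ℝ ℝ ℝ - c' e • ContinuousLinearMap.snd ℝ ℝ ℝ)
    simpa [D] using this
  have hDind : iIndepFun D P :=
    hZ.indep_bridges.comp (fun e p => c e * p (s e) - c' e * p (s' e)) fun e =>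
      ((measurable_pi_apply _).const_mul _).sub ((measurable_pi_apply _).const_mul _)
  have hsum : HasGaussianLaw (fun ω => ∑ e, D e ω) P := hDind.hasGaussianLaw_fun_sum hD
  have hind : IndepFun I (fun ω => ∑ e, D e ω) P := by
    refine hZ.indep_vertices_bridges.comp (φ := fun z => (L - L') (WithLp.toLp 2 z))
      (ψ := fun p => ∑ e, (c e * p e (s e) - c' e * p e (s' e))) (by fun_prop) (by fun_prop)
  have hG : HasGaussianLaw (fun ω => I ω + ∑ e, D e ω) P :=
    iIndepFun.hasGaussianLaw_fun_add hI hsum hind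
  have hmI : ∫ ω, I ω ∂P = 0 := by
    rw [ContinuousLinearMap.integral_comp_comm _ hvec.integrable, hZ.law_vertices.integral_eq]
    simp
  have hmD : ∀ e, ∫ ω, D e ω ∂P = 0 := by
    intro e
    have hi : ∀ t, Integrable (B e t) P := fun t =>
      ((hZ.bridges e).gaussian.hasGaussianLaw_eval t).integrable
    rw [integral_sub ((hi _).const_mul _) ((hi _).const_mul _), integral_const_mul,
      integral_const_mul, (hZ.bridges e).mean, (hZ.bridges e).mean]
    simp
  have hmean : ∫ ω, (I ω + ∑ e, D e ω) ∂P = 0 := by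
    rw [integral_add hI.integrable hsum.integrable, hmI,
      integral_finsetSum _ fun e _ => (hD e).integrable]
    simp [hmD]
  rw [resistanceMetric, variogram, hsub, hG.map_eq_gaussianReal, hmean]

end EuclideanEdgeGraph

/-! ### The covariogram and its Gaussian means -/

section Covariogram

variable {f : ℝ → ℝ}

theorem integrable_covariogram (hf : MemLp f 2 volume) (h : ℝ) :
    Integrable fun x => f (x + h) * f x :=
  (hf.comp_measurePreserving (measurePreserving_add_right volume h)).integrable_mul hf

/-- From `|ab| ≤ (a² + b²) / 2` and translation invariance. Boundedness makes the Gaussian integrals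
of the covariogram converge. -/
theorem norm_covariogram_le (hf : MemLp f 2 volume) (h : ℝ) :
    ‖covariogram f h‖ ≤ ∫ x, f x ^ 2 := by
  have hsq := hf.integrable_sq
  have h1 : Integrable fun x => (f (x + h) ^ 2 + f x ^ 2) / 2 :=
    ((hsq.comp_add_right h).add hsq).div_const 2
  refine (norm_integral_le_of_norm_le h1 (ae_of_all _ fun x => ?_)).trans_eq ?_
  · rw [Real.norm_eq_abs, abs_le]
    constructor <;> nlinarith [sq_nonneg (f (x + h) + f x), sq_nonneg (f (x + h) - f x)]
  · rw [integral_div, integral_add (hsq.comp_add_right h) hsq,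
      integral_add_right_eq_self (fun x => f x ^ 2) h]
    ring

theorem covariogram_congr {g : ℝ → ℝ} (hfg : f =ᵐ[volume] g) : covariogram f = covariogram g := by
  ext h
  refine integral_congr_ae ?_
  filter_upwards [hfg, (measurePreserving_add_right volume h).quasiMeasurePreserving.ae hfg]
    with x h1 h2
  rw [h1, h2]

theorem measurable_covariogram (hf : MemLp f 2 volume) : Measurable (covariogram f) := by
  have hm := hf.1.stronglyMeasurable_mk.measurable
  rw [covariogram_congr hf.1.ae_eq_mk]
  refine (StronglyMeasurable.integral_prod_right
    (f := fun h x => hf.1.mk f (x + h) * hf.1.mk f x) ?_).measurable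
  exact ((hm.comp (measurable_snd.add measurable_fst)).mul
    (hm.comp measurable_snd)).stronglyMeasurable

/-- The substitution `x ↦ b - x`. Through it the covariogram enters the covariance. -/
theorem integral_mul_shift (f : ℝ → ℝ) (a b : ℝ) :
    ∫ x, f (a - x) * f (b - x) = covariogram f (a - b) := by
  rw [covariogram, ← integral_sub_left_eq_self (fun x => f (x + (a - b)) * f x) volume b]
  congr 1
  ext x
  ring_nf

/-- The shifts of a square-integrable function by a random amount are square-integrable on the
product space. -/
theorem memLp_shift {E : Type*} [MeasurableSpace E] {ν : Measure E} [IsFiniteMeasure ν]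
    (hfm : Measurable f) (hf : MemLp f 2 volume) {w : E → ℝ} (hw : Measurable w) :
    MemLp (fun p : E × ℝ => f (w p.1 - p.2)) 2 (ν.prod volume) := by
  have hm : Measurable fun p : E × ℝ => f (w p.1 - p.2) :=
    hfm.comp ((hw.comp measurable_fst).sub measurable_snd)
  rw [memLp_two_iff_integrable_sq hm.aestronglyMeasurable,
    integrable_prod_iff (hm.pow_const 2).aestronglyMeasurable]
  refine ⟨ae_of_all _ fun e => hf.integrable_sq.comp_sub_left (w e), ?_⟩
  have : ∀ e, ∫ x, ‖f (w e - x) ^ 2‖ = ∫ x, ‖f x ^ 2‖ := fun e =>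
    integral_sub_left_eq_self (fun x => ‖f x ^ 2‖) volume (w e)
  simp only [this]
  exact integrable_const _

/-- The mean of the covariogram over a centred Gaussian law. -/
theorem integral_covariogram_gaussianReal (f : ℝ → ℝ) (d : ℝ) (hf : MemLp f 2 volume) :
    ∫ h, covariogram f h ∂(gaussianReal 0 d.toNNReal) =
      1 / √(2 * Real.pi) * ∫ z, covariogram f (√d * z) * Real.exp (-z ^ 2 / 2) := by
  have hmap : (gaussianReal 0 1).map (√d * ·) = gaussianReal 0 d.toNNReal := by
    rw [gaussianReal_map_const_mul]
    congr 1
    · simp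
    · ext
      simp only [mul_one, NNReal.coe_mk, Real.coe_toNNReal']
      -- For `d ≤ 0` both `√d` and `d.toNNReal` are `0`, and both laws are the Dirac mass at `0`.
      rcases le_total 0 d with h | h
      · rw [Real.sq_sqrt h, max_eq_left h]
      · rw [Real.sqrt_eq_zero_of_nonpos h, max_eq_right h]
        simp
  rw [← hmap, integral_map (by fun_prop) (measurable_covariogram hf).aestronglyMeasurable,
    integral_gaussianReal_eq_integral_smul one_ne_zero, ← integral_const_mul]
  refine integral_congr_ae (ae_of_all _ fun z => ?_)
  simp only [gaussianPDFReal, NNReal.coe_one, mul_one, sub_zero, smul_eq_mul]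
  ring

theorem integrable_covariogram_mul_exp (hf : MemLp f 2 volume) (c : ℝ) :
    Integrable fun z => covariogram f (c * z) * Real.exp (-z ^ 2 / 2) := by
  have hexp : Integrable fun z : ℝ => Real.exp (-z ^ 2 / 2) := by
    refine (integrable_exp_neg_mul_sq (b := 1 / 2) (by norm_num)).congr (ae_of_all _ fun z => ?_)
    ring_nf
  exact hexp.bdd_mul
    ((measurable_covariogram hf).comp (measurable_const_mul c)).aestronglyMeasurable
    (ae_of_all _ fun z => norm_covariogram_le hf _)

end Covariogram

/-! ### Inner products of series and consequences of Campbell's formula -/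

/-- The inner product of the sums of two biorthogonal sequences. -/
theorem hasSum_inner_tsum_of_biorthogonal {H : Type*} [NormedAddCommGroup H]
    [InnerProductSpace ℝ H] {g k : ℕ → H} (hg : Summable g) (hk : Summable k) {c : ℕ → ℝ}
    (h : ∀ i j, inner ℝ (g i) (k j) = if i = j then c i else 0) :
    HasSum c (inner ℝ (∑' n, g n) (∑' n, k n)) := by
  have h1 : ∀ n, inner ℝ (∑' m, k m) (g n) = c n := by
    intro n
    have h2 := (innerSL ℝ (g n)).hasSum hk.hasSum
    simp only [innerSL_apply_apply, h] at h2
    rw [real_inner_comm]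
    have h3 := hasSum_ite_eq n (c n)
    simp only [eq_comm (b := n)] at h3
    exact h2.unique h3
  have h4 := (innerSL ℝ (∑' m, k m)).hasSum hg.hasSum
  simp only [innerSL_apply_apply, h1] at h4
  rwa [real_inner_comm]

section Campbell

variable {Ω E : Type*} [MeasurableSpace Ω] [MeasurableSpace E] {P : Measure Ω}
  {W : Ω → E} {T : ℕ → Ω → ℝ} {ν : Measure (E × ℝ)}

theorem ae_forall_of_sum_map (hW : Measurable W) (hT : ∀ n, Measurable (T n))
    (hν : Measure.sum (fun n => P.map fun ω => (W ω, T n ω)) = ν) {p : E × ℝ → Prop}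
    (hp : ∀ᵐ x ∂ν, p x) : ∀ᵐ ω ∂P, ∀ n, p (W ω, T n ω) := by
  rw [← hν, Measure.ae_sum_iff] at hp
  exact ae_all_iff.2 fun n => ae_of_ae_map (hW.prodMk (hT n)).aemeasurable (hp n)

theorem memLp_of_sum_map (hW : Measurable W) (hT : ∀ n, Measurable (T n))
    (hν : Measure.sum (fun n => P.map fun ω => (W ω, T n ω)) = ν) {κ : E × ℝ → ℝ} {p : ℝ≥0∞}
    (hκ : MemLp κ p ν) (n : ℕ) : MemLp (fun ω => κ (W ω, T n ω)) p P :=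
  (hκ.mono_measure (hν ▸ Measure.le_sum (fun n => P.map fun ω => (W ω, T n ω)) n)).comp_of_map
    (hW.prodMk (hT n)).aemeasurable

theorem hasSum_integral_of_sum_map (hW : Measurable W) (hT : ∀ n, Measurable (T n))
    (hν : Measure.sum (fun n => P.map fun ω => (W ω, T n ω)) = ν) {κ : E × ℝ → ℝ}
    (hκ : Integrable κ ν) : HasSum (fun n => ∫ ω, κ (W ω, T n ω) ∂P) (∫ x, κ x ∂ν) := by
  subst hν
  refine (hasSum_integral_measure hκ).congr_fun fun n => ?_
  exact (integral_map (hW.prodMk (hT n)).aemeasurable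
    (hκ.1.mono_measure (Measure.le_sum _ n))).symm

/-- The mean of the sum of the absolute values is the integral of `|κ|` against `ν`; being finite,
it forces the sum to be finite almost surely. -/
theorem ae_summable_of_sum_map (hW : Measurable W) (hT : ∀ n, Measurable (T n))
    (hν : Measure.sum (fun n => P.map fun ω => (W ω, T n ω)) = ν) {κ : E × ℝ → ℝ}
    (hκm : Measurable κ) (hκ : Integrable κ ν) : ∀ᵐ ω ∂P, Summable fun n => κ (W ω, T n ω) := by
  have hm : ∀ n, Measurable fun ω => ‖κ (W ω, T n ω)‖ₑ := fun n =>
    (hκm.comp (hW.prodMk (hT n))).enorm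
  have hfin : ∫⁻ ω, ∑' n, ‖κ (W ω, T n ω)‖ₑ ∂P ≠ ∞ := by
    rw [lintegral_tsum fun n => (hm n).aemeasurable]
    have h1 := hκ.2
    rw [HasFiniteIntegral, ← hν, lintegral_sum_measure] at h1
    simp only [lintegral_map hκm.enorm (hW.prodMk (hT _))] at h1
    exact h1.ne
  filter_upwards [ae_lt_top (Measurable.tsum hm) hfin] with ω hω
  refine Summable.of_norm ?_
  have := ENNReal.summable_toReal hω.ne
  simpa using this

end Campbell

/-! ### Convergence and covariance of the dilution series -/

/-- The window sum along an enumeration of the point set. -/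
theorem windowSum_eq_finsum {S Ω : Type*} {X : Ω → Set ℝ} (ε : ℝ → Ω → ℝ) (f : ℝ → ℝ)
    (Z : S → Ω → ℝ) {T : ℕ → Ω → ℝ} {ω : Ω} (hinj : Function.Injective fun n => T n ω)
    (hrange : Set.range (fun n => T n ω) = X ω) (a b : ℝ) (u : S) :
    windowSum X ε f Z a b u ω =
      ∑ᶠ n ∈ {n | T n ω ∈ Set.Icc a b}, ε (T n ω) ω * f (Z u ω - T n ω) := by
  rw [windowSum, ← hrange, ← Set.image_preimage_eq_range_inter,
    finsum_mem_image hinj.injOn]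
  rfl

theorem ae_finite_enumeration {Ω : Type*} [MeasurableSpace Ω] {P : Measure Ω} {X : Ω → Set ℝ}
    (hX : IsUnitPoissonProcess X P) {T : ℕ → Ω → ℝ}
    (hTX : ∀ᵐ ω ∂P, Function.Injective (fun n => T n ω) ∧ Set.range (fun n => T n ω) = X ω) :
    ∀ᵐ ω ∂P, ∀ a b, {n | T n ω ∈ Set.Icc a b}.Finite := by
  filter_upwards [hTX] with ω hω a b
  refine ((hX.locallyFinite ω a b).preimage (f := fun n => T n ω) hω.1.injOn).subset ?_
  exact fun n hn => ⟨hω.2 ▸ Set.mem_range_self n, hn⟩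

section Dilution

variable {S Ω : Type*} [MeasurableSpace Ω] {P : Measure Ω} [IsProbabilityMeasure P]
  {X : Ω → Set ℝ} {ε : ℝ → Ω → ℝ} {Z : S → Ω → ℝ} {f : ℝ → ℝ}

/-- The dilution series converges almost surely along every exhausting sequence of windows, and its
limit is a centred second-order field whose covariances are the means of the covariogram at the
increments of `Z`. -/
theorem exists_dilution_limit (hZ : ∀ u, Measurable (Z u)) (hX : IsUnitPoissonProcess X P)
    (hXZ : PointProcessIndep X Z P) (hε : IsRademacherMarking X ε Z P)
    (hf : MemLp f 2 volume) :
    ∃ Y : S → Lp ℝ 2 P,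
      (∀ u, ∀ c d : ℕ → ℝ, Antitone c → Monotone d → (⋃ k, Set.Icc (c k) (d k)) = Set.univ →
        ∀ᵐ ω ∂P, Tendsto (fun k => windowSum X ε f Z (c k) (d k) u ω) atTop (𝓝 (Y u ω))) ∧
      (∀ u, ∫ ω, Y u ω ∂P = 0) ∧
      ∀ u v, inner ℝ (Y u) (Y v) = ∫ ω, covariogram f (Z u ω - Z v ω) ∂P := by
  obtain ⟨T, hT, hTX, hεm, hlaw, hindep, hind⟩ := hε
  have hξ : IsRademacherSequence (fun n ω => ε (T n ω) ω) P := ⟨hεm, hlaw, hindep⟩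
  set ξ : ℕ → Ω → ℝ := fun n ω => ε (T n ω) ω
  obtain ⟨f', hf'm, hff'⟩ : ∃ f' : ℝ → ℝ, Measurable f' ∧ f =ᵐ[volume] f' :=
    ⟨hf.1.mk f, hf.1.stronglyMeasurable_mk.measurable, hf.1.ae_eq_mk⟩
  have hf' : MemLp f' 2 volume := hf.ae_eq hff'
  -- Campbell's formula for the pairs of values of `Z`
  have hW : ∀ u v, Measurable fun ω => (Z u ω, Z v ω) := fun u v => (hZ u).prodMk (hZ v)
  have hν : ∀ u v, Measure.sum (fun n => P.map fun ω => ((Z u ω, Z v ω), T n ω)) =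
      (P.map fun ω => (Z u ω, Z v ω)).prod volume := fun u v =>
    hX.sum_map_eq_prod hT hTX (hW u v)
      (hXZ.comp measurable_id ((measurable_pi_apply u).prodMk (measurable_pi_apply v)))
  have hpr : ∀ u v, IsProbabilityMeasure (P.map fun ω => (Z u ω, Z v ω)) := fun u v =>
    Measure.isProbabilityMeasure_map (hW u v).aemeasurable
  have hL : ∀ u v, MemLp (fun p : (ℝ × ℝ) × ℝ => f' (p.1.1 - p.2)) 2
      ((P.map fun ω => (Z u ω, Z v ω)).prod volume) := fun u v =>
    memLp_shift hf'm hf' measurable_fst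
  have hR : ∀ u v, MemLp (fun p : (ℝ × ℝ) × ℝ => f' (p.1.2 - p.2)) 2
      ((P.map fun ω => (Z u ω, Z v ω)).prod volume) := fun u v =>
    memLp_shift hf'm hf' measurable_snd
  have hcoef : ∀ u n, MemLp (fun ω => f' (Z u ω - T n ω)) 2 P := fun u n =>
    memLp_of_sum_map (hW u u) hT (hν u u) (hL u u) n
  have hcov : ∀ u v, HasSum (fun n => ∫ ω, f' (Z u ω - T n ω) * f' (Z v ω - T n ω) ∂P)
      (∫ ω, covariogram f (Z u ω - Z v ω) ∂P) := by
    intro u v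
    have hint := (hL u v).integrable_mul (hR u v)
    have hs := hasSum_integral_of_sum_map (hW u v) hT (hν u v) hint
    rw [integral_prod _ hint] at hs
    simp only [Pi.mul_apply, integral_mul_shift, ← covariogram_congr hff'] at hs
    have hm : Measurable fun p : ℝ × ℝ => covariogram f (p.1 - p.2) :=
      (measurable_covariogram hf).comp (measurable_fst.sub measurable_snd)
    rwa [integral_map (hW u v).aemeasurable hm.aestronglyMeasurable] at hs
  have hsumm : ∀ u, ∀ᵐ ω ∂P, Summable fun n => f' (Z u ω - T n ω) ^ 2 := fun u =>
    ae_summable_of_sum_map (hW u u) hT (hν u u) (κ := fun p => f' (p.1.1 - p.2) ^ 2)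
      ((hf'm.comp ((measurable_fst.comp measurable_fst).sub measurable_snd)).pow_const 2)
      (hL u u).integrable_sq
  -- The points have Lebesgue intensity given `Z`, so almost surely no `Z u - T n` falls in the null
  -- set where `f` and its measurable version `f'` differ.
  have hrepr : ∀ u, ∀ᵐ ω ∂P, ∀ n, f (Z u ω - T n ω) = f' (Z u ω - T n ω) := by
    intro u
    have h0 : ∀ᵐ x, x ∉ toMeasurable volume {x | f x ≠ f' x} := by
      rw [ae_iff]
      simp only [not_not, Set.ofPred_mem_eq, measure_toMeasurable]
      exact hff'
    have h1 : ∀ᵐ p ∂(P.map fun ω => (Z u ω, Z u ω)).prod volume,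
        p.1.1 - p.2 ∉ toMeasurable volume {x | f x ≠ f' x} := by
      rw [Measure.ae_prod_iff_ae_ae]
      · exact ae_of_all _ fun w =>
          (volume.measurePreserving_sub_left w.1).quasiMeasurePreserving.ae h0
      · exact (measurable_fst.comp measurable_fst).sub measurable_snd
          (measurableSet_toMeasurable _ _).compl
    filter_upwards [ae_forall_of_sum_map (hW u u) hT (hν u u) h1] with ω hω n
    by_contra hne
    exact hω n (subset_toMeasurable _ _ hne)
  -- the terms of the series are orthogonal
  have hterm : ∀ u n, MemLp (fun ω => ξ n ω * f' (Z u ω - T n ω)) 2 P := by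
    intro u n
    refine (hcoef u n).mono ((hξ.measurable n).aestronglyMeasurable.mul (hcoef u n).1) ?_
    filter_upwards [hξ.ae_norm_le n] with ω hω
    rw [norm_mul]
    exact mul_le_of_le_one_left (norm_nonneg _) hω
  have hmul : ∀ u v m n, ∫ ω, (ξ m ω * f' (Z u ω - T m ω)) * (ξ n ω * f' (Z v ω - T n ω)) ∂P =
      if m = n then ∫ ω, f' (Z u ω - T m ω) * f' (Z v ω - T m ω) ∂P else 0 := by
    intro u v m n
    have hi : IndepFun (fun ω => ξ m ω * ξ n ω)
        (fun ω => f' (Z u ω - T m ω) * f' (Z v ω - T n ω)) P := by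
      refine hind.comp (φ := fun x => x m * x n)
        (ψ := fun p => f' (p.2 u - p.1 m) * f' (p.2 v - p.1 n)) (by fun_prop) ?_
      fun_prop
    have := hi.integral_mul_eq_mul_integral
      ((hξ.measurable m).mul (hξ.measurable n)).aestronglyMeasurable
      ((hcoef u m).1.mul (hcoef v n).1)
    simp only [Pi.mul_def] at this
    rw [hξ.integral_mul] at this
    simp only [mul_mul_mul_comm (ξ m _), this]
    split_ifs with hmn
    · subst hmn; exact one_mul _
    · exact zero_mul _
  have hmean : ∀ u n, ∫ ω, ξ n ω * f' (Z u ω - T n ω) ∂P = 0 := by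
    intro u n
    have hi : IndepFun (ξ n) (fun ω => f' (Z u ω - T n ω)) P := by
      have hψ : Measurable fun p : (ℕ → ℝ) × (S → ℝ) => f' (p.2 u - p.1 n) := by fun_prop
      exact hind.comp (measurable_pi_apply n : Measurable fun x : ℕ → ℝ => x n) hψ
    have := hi.integral_mul_eq_mul_integral (hξ.measurable n).aestronglyMeasurable (hcoef u n).1
    rw [hξ.integral_eq_zero, zero_mul] at this
    exact this
  obtain ⟨g, hg⟩ : ∃ g : S → ℕ → Lp ℝ 2 P,
      ∀ u n, g u n =ᵐ[P] fun ω => ξ n ω * f' (Z u ω - T n ω) :=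
    ⟨fun u n => (hterm u n).toLp, fun u n => (hterm u n).coeFn_toLp⟩
  have hin : ∀ u v m n, inner ℝ (g u m) (g v n) =
      if m = n then ∫ ω, f' (Z u ω - T m ω) * f' (Z v ω - T m ω) ∂P else 0 := by
    intro u v m n
    rw [L2.inner_def, ← hmul]
    refine integral_congr_ae ?_
    filter_upwards [hg u m, hg v n] with ω h1 h2
    simp only [h1, h2, RCLike.inner_apply, conj_trivial]
    ring
  have hgs : ∀ u, Summable (g u) := by
    intro u
    refine summable_of_pairwise_inner_eq_zero (fun i j hij => (hin u u i j).trans (if_neg hij))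
      ((hcov u u).summable.congr fun n => ?_)
    rw [← real_inner_self_eq_norm_sq, hin, if_pos rfl]
  have hpart : ∀ u, ∀ᵐ ω ∂P, ∀ N, (∑ n ∈ Finset.range N, g u n : Lp ℝ 2 P) ω =
      ∑ n ∈ Finset.range N, f' (Z u ω - T n ω) * ξ n ω := by
    intro u
    refine ae_all_iff.2 fun N => ?_
    filter_upwards [Lp.coeFn_fun_finsetSum (Finset.range N) (g u), ae_all_iff.2 (hg u)]
      with ω h1 h2
    rw [h1]
    exact Finset.sum_congr rfl fun n _ => by rw [h2, mul_comm]
  refine ⟨fun u => ∑' n, g u n, fun u c d hc hd hcd => ?_, fun u => ?_, fun u v => ?_⟩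
  · have hθ : Measurable fun ω => (fun n => T n ω, Z u ω) := (measurable_pi_lambda _ hT).prodMk (hZ u)
    have hconv := hξ.ae_tendsto_finsum_of_indepFun hθ
      (hind.comp measurable_id
        (measurable_fst.prodMk ((measurable_pi_apply u).comp measurable_snd)))
      (a := fun n p => f' (p.2 - p.1 n)) (fun n => by fun_prop)
      (A := fun k n => {p | p.1 n ∈ Set.Icc (c k) (d k)})
      (fun k n => (measurable_pi_apply n).comp measurable_fst measurableSet_Icc)
      (hsumm u)
      (by
        filter_upwards [ae_finite_enumeration hX hTX] with ω hω k
        exact hω _ _)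
      (ae_of_all _ fun ω n i j hij hi => Set.Icc_subset_Icc (hc hij) (hd hij) hi)
      (ae_of_all _ fun ω n => by
        have : T n ω ∈ ⋃ k, Set.Icc (c k) (d k) := hcd ▸ Set.mem_univ _
        obtain ⟨k, hk⟩ := Set.mem_iUnion.1 this
        exact ⟨k, hk⟩)
    -- A subsequence of the partial sums tends almost surely to the `L²` sum, which identifies the
    -- pathwise limit `s`, common to all windows.
    obtain ⟨ns, hns, hsub⟩ :=
      (tendstoInMeasure_of_tendsto_Lp (hgs u).hasSum.tendsto_sum_nat).exists_seq_tendsto_ae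
    filter_upwards [hconv, hsub, hpart u, hTX, hrepr u] with ω ⟨s, h1, h2⟩ h3 h4 h5 h6
    simp only [h4] at h3
    rw [tendsto_nhds_unique h3 (h2.comp hns.tendsto_atTop)]
    refine h1.congr fun k => ?_
    rw [windowSum_eq_finsum ε f Z h5.1 h5.2]
    refine finsum_mem_congr rfl fun n _ => ?_
    rw [h6, mul_comm]
  -- Expectation is the inner product with the constant `1`, hence continuous on `L²`, and may be
  -- taken term by term.
  · have h1 : ∀ F : Lp ℝ 2 P, inner ℝ
        (indicatorConstLp 2 MeasurableSet.univ (measure_ne_top P _) (1 : ℝ)) F = ∫ ω, F ω ∂P := by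
      intro F
      rw [L2.inner_indicatorConstLp_one, setIntegral_univ]
    have h2 := (innerSL ℝ
      (indicatorConstLp 2 MeasurableSet.univ (measure_ne_top P _) (1 : ℝ))).hasSum (hgs u).hasSum
    simp only [innerSL_apply_apply, h1, fun n => (integral_congr_ae (hg u n)).trans (hmean u n)]
      at h2
    exact h2.unique hasSum_zero
  · exact (hasSum_inner_tsum_of_biorthogonal (hgs u) (hgs v) (hin u v)).unique (hcov u v)

end Dilution

/-! ### The dilution field on the graph -/

theorem proposition3 {V : Type*} [Fintype V] [DecidableEq V] (G : EuclideanEdgeGraph V)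
    {Ω : Type*} [MeasurableSpace Ω] (P : Measure Ω) [IsProbabilityMeasure P]
    (u₀ : V) (Zμ : V → Ω → ℝ) (B : ∀ e, Set.Icc (G.lo e) (G.hi e) → Ω → ℝ)
    (hZ : G.IsAuxiliary u₀ Zμ B P)
    (X : Ω → Set ℝ) (hX : IsUnitPoissonProcess X P)
    (hXZ : PointProcessIndep X (G.auxiliaryField Zμ B) P)
    (ε : ℝ → Ω → ℝ) (hε : IsRademacherMarking X ε (G.auxiliaryField Zμ B) P)
    (f : ℝ → ℝ) (hf : MemLp f 2 volume)
    (Y : G.Point → Ω → ℝ) (hY : Y = dilutionField X ε f (G.auxiliaryField Zμ B)) :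
    -- the series defining `Y` converges almost surely, along all exhausting sequences of windows
    (∀ u, ∀ c d : ℕ → ℝ, Antitone c → Monotone d → (⋃ k, Set.Icc (c k) (d k)) = Set.univ →
      ∀ᵐ ω ∂P, Tendsto (fun k => windowSum X ε f (G.auxiliaryField Zμ B) (c k) (d k) u ω)
        atTop (𝓝 (Y u ω))) ∧
    -- `Y` is a second-order random field with mean zero
    (∀ u, MemLp (Y u) 2 P ∧ ∫ ω, Y u ω ∂P = 0) ∧
    -- its covariance function is isotropic with respect to the resistance metric
    IsIsotropic (covFun Y P) (G.resistanceMetric Zμ B P) ∧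
    -- and is given by the covariogram of `f`, through convergent integrals
    (∀ h, Integrable fun x => f (x + h) * f x) ∧
    ∀ u v,
      Integrable (fun z => covariogram f (√(G.resistanceMetric Zμ B P u v) * z)
        * Real.exp (-z ^ 2 / 2)) ∧
      covFun Y P u v = 1 / √(2 * Real.pi) *
        ∫ z, covariogram f (√(G.resistanceMetric Zμ B P u v) * z) * Real.exp (-z ^ 2 / 2) := by
  obtain ⟨y, hconv, hmean, hinner⟩ :=
    exists_dilution_limit (fun u => hZ.measurable_auxiliaryField u) hX hXZ hε hf
  have hYy : ∀ u, Y u =ᵐ[P] y u := by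
    intro u
    have hwin : (⋃ k : ℕ, Set.Icc (-(k : ℝ)) k) = Set.univ := by
      refine Set.eq_univ_of_forall fun x => Set.mem_iUnion.2 ?_
      obtain ⟨k, hk⟩ := exists_nat_ge |x|
      exact ⟨k, abs_le.1 hk⟩
    filter_upwards [hconv u (fun k => -(k : ℝ)) (fun k => k)
      (fun i j hij => neg_le_neg (Nat.cast_le.2 hij)) Nat.mono_cast hwin] with ω hω
    rw [hY]
    exact hω.limUnder_eq
  have hmem : ∀ u, MemLp (Y u) 2 P := fun u => (memLp_congr_ae (hYy u)).2 (Lp.memLp (y u))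
  have hmean' : ∀ u, ∫ ω, Y u ω ∂P = 0 := fun u => (integral_congr_ae (hYy u)).trans (hmean u)
  have hcov : ∀ u v, covFun Y P u v = 1 / √(2 * Real.pi) *
      ∫ z, covariogram f (√(G.resistanceMetric Zμ B P u v) * z) * Real.exp (-z ^ 2 / 2) := by
    intro u v
    have hm : Measurable fun ω => G.auxiliaryField Zμ B u ω - G.auxiliaryField Zμ B v ω :=
      (hZ.measurable_auxiliaryField u).sub (hZ.measurable_auxiliaryField v)
    -- The right side is rewritten as the mean of the covariogram at `Z u - Z v`, hence as an `L²`
    -- inner product, which is the covariance because the means vanish.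
    rw [← integral_covariogram_gaussianReal f _ hf, ← hZ.map_sub_eq_gaussianReal u v,
      integral_map hm.aemeasurable
        (measurable_covariogram hf).aestronglyMeasurable, ← hinner, L2.inner_def, covFun,
      covariance_eq_sub (hmem u) (hmem v), hmean', zero_mul, sub_zero]
    refine integral_congr_ae ?_
    filter_upwards [hYy u, hYy v] with ω h1 h2
    simp only [Pi.mul_apply, h1, h2, RCLike.inner_apply, conj_trivial]
    ring
  refine ⟨fun u c d hc hd hcd => ?_, fun u => ⟨hmem u, hmean' u⟩,
    ⟨fun r => 1 / √(2 * Real.pi) * ∫ z, covariogram f (√r * z) * Real.exp (-z ^ 2 / 2), hcov⟩,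
    integrable_covariogram hf, fun u v => ⟨integrable_covariogram_mul_exp hf _, hcov u v⟩⟩
  filter_upwards [hconv u c d hc hd hcd, hYy u] with ω h1 h2
  rwa [h2]
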